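/- Fix an integer $n\ge 0$ and a real number $q$ with $0\le q\le 1$. Let $\mathcal B_n$ be the set of words of length $n$ in the letters $\bullet$ (particle) and $\circ$ (empty cell). The PASEP on $n$ cells with parameters $\alpha,\beta,q$ is the Markov chain on $\mathcal B_n$ with transition probabilities $P_{X,Y}=\frac1{n+1}$ and $P_{Y,X}=\frac q{n+1}$ if $X=A\bullet\circ B$ and $Y=A\circ\bullet B$; $P_{X,Y}=\frac{\alpha}{n+1}$ if $X=\circ B$ and $Y=\bullet B$; $P_{X,Y}=\frac{\beta}{n+1}$ if $X=B\bullet$ and $Y=B\circ$; $P_{X,Y}=0$ for all other $Y\ne X$; and $P_{X,X}=1-\sum_{Y\neq X}P_{X,Y}$. Put $[m]_q=1+q+\cdots+q^{m-1}$. A bicolored Motzkin path of length $n$ is a sequence $c=(c_1,\dots,c_n)$ of steps in $\{N,E,\bar E,S\}$, where $N$ raises the height by $1$, $S$ lowers it by $1$ and $E,\bar E$ keep it, which starts and ends at height $0$ and never goes below $0$. The weight $w(c)$ is the product of the weights of the steps, where a step starting at height $h$ has weight $[h+1]_q$ if it is $N$, $[h]_q+q^h/\alpha$ if it is $\bar E$,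 $[h]_q+q^h/\beta$ if it is $E$, and $[h]_q+q^h/(\alpha\beta)-q^{h-1}(1/\alpha-1)(1/\beta-1)$ if it is $S$. Replacing each $N$ and $E$ by $\bullet$ and each $\bar E$ and $S$ by $\circ$ turns $c$ into a configuration $\theta(c)\in\mathcal B_n$. Let $W(X)=\sum_{\theta(c)=X}w(c)$ and $Z_n=\sum_{X\in\mathcal B_n}W(X)$. For $k,n\ge1$ let $$\hat E_{k,n}(q)=q^{k-k^2}\sum_{i=0}^{k-1}(-1)^i[k-i]_q^{\,n}\,q^{k(i-1)}\left(\binom ni q^{k-i}+\binom n{i-1}\right),\qquad \binom n{-1}=0 .$$ **Theorem.** For every $k\ge 0$, the Laurent polynomial $\hat E_{k+1,n+1}(q)$ is a polynomial in $q$ with integer coefficients (so that its value at $q=0$ makes sense). Let $\alpha=\beta=1$. Then the PASEP on $n$ cells has a unique stationary distribution, $Z_n>0$, and at the steady state the probability that the chain is in a configuration with exactly $k$ particles (that is, the sum of the stationary probabilities of all $X\in\mathcal B_n$ with exactly $k$ letters $\bullet$) is $$\frac{\hat E_{k+1,n+1}(q)}{Z_n}.$$ -/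

import Mathlib

namespace PASEP

/-! ### The Markov chain -/

/-- A basic configuration: a row of `n` cells, `true` for a black particle `•` (occupied cell) and
`false` for a white particle `∘` (empty cell). Cell `0` is the leftmost one. -/
abbrev Config (n : ℕ) : Type := Fin n → Bool

/-- The number of (black) particles of a configuration. -/
def numParticles {n : ℕ} (X : Config n) : ℕ :=
  (Finset.univ.filter fun i => X i = true).card

/-- `X = A•∘B` and `Y = A∘•B`. -/
def IsHop {n : ℕ} (X Y : Config n) : Prop :=
  ∃ i j : Fin n, (i : ℕ) + 1 = j ∧ X i = true ∧ X j = false ∧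
    Y = Function.update (Function.update X i false) j true

/-- `X = ∘B` and `Y = •B`. -/
def IsEntry {n : ℕ} (X Y : Config n) : Prop :=
  ∃ i : Fin n, (i : ℕ) = 0 ∧ X i = false ∧ Y = Function.update X i true

/-- `X = B•` and `Y = B∘`. -/
def IsExit {n : ℕ} (X Y : Config n) : Prop :=
  ∃ i : Fin n, (i : ℕ) + 1 = n ∧ X i = true ∧ Y = Function.update X i false

instance {n : ℕ} (X Y : Config n) : Decidable (IsHop X Y) := by
  unfold IsHop; infer_instance

instance {n : ℕ} (X Y : Config n) : Decidable (IsEntry X Y) := by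
  unfold IsEntry; infer_instance

instance {n : ℕ} (X Y : Config n) : Decidable (IsExit X Y) := by
  unfold IsExit; infer_instance

/-- The probability of a jump from `X` to a different configuration `Y`. -/
noncomputable def jump {n : ℕ} (α β q : ℝ) (X Y : Config n) : ℝ :=
  if IsHop X Y then 1 / (n + 1)
  else if IsHop Y X then q / (n + 1)
  else if IsEntry X Y then α / (n + 1)
  else if IsExit X Y then β / (n + 1)
  else 0

/-- The transition matrix of the PASEP on `n` cells with parameters `α`, `β`, `q`. -/
noncomputable def transitionMatrix (n : ℕ) (α β q : ℝ) : Matrix (Config n) (Config n) ℝ :=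
  fun X Y =>
    if X = Y then 1 - ∑ Y' ∈ Finset.univ.filter (fun Y' => Y' ≠ X), jump α β q X Y'
    else jump α β q X Y

/-- A stationary distribution of a transition matrix on a finite state space: a probability vector
`π` with `π P = π`. -/
def IsStationary {S : Type*} [Fintype S] (P : Matrix S S ℝ) (π : S → ℝ) : Prop :=
  π ∈ stdSimplex ℝ S ∧ Matrix.vecMul π P = π

/-! ### Weighted bicolored Motzkin paths and the normalization `Z_n` -/

/-- The `q`-integer `[m]_q = 1 + q + ⋯ + q^(m-1)`. -/
def qInt {R : Type*} [Semiring R] (q : R) (m : ℕ) : R :=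
  ∑ i ∈ Finset.range m, q ^ i

/-- The steps `N`, `E`, `Ē`, `S` of a bicolored Motzkin path. -/
inductive Step : Type
  | N
  | E
  | Ebar
  | S
  deriving DecidableEq

instance : Fintype Step where
  elems := {.N, .E, .Ebar, .S}
  complete := by intro s; cases s <;> simp

/-- The change of height along a step. -/
def Step.rise : Step → ℤ
  | .N => 1
  | .E => 0
  | .Ebar => 0
  | .S => -1

/-- The colour of the cell that a step is changed to: `N, E ↦ •` and `Ē, S ↦ ∘`. -/
def Step.color : Step → Bool
  | .N => true
  | .E => true
  | .Ebar => false
  | .S => false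

/-- The height reached after the first `i` steps. -/
def height {n : ℕ} (c : Fin n → Step) (i : ℕ) : ℤ :=
  ∑ j ∈ Finset.univ.filter (fun j : Fin n => (j : ℕ) < i), (c j).rise

/-- A sequence of steps is a bicolored Motzkin path if it stays weakly above height `0` and
ends at height `0`. -/
def IsMotzkin {n : ℕ} (c : Fin n → Step) : Prop :=
  (∀ i ≤ n, 0 ≤ height c i) ∧ height c n = 0

instance {n : ℕ} (c : Fin n → Step) : Decidable (IsMotzkin c) := by
  unfold IsMotzkin; infer_instance

/-- The weight of a step that starts at height `h`. A step `S` of a Motzkin path starts at height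
`h ≥ 1`, so the truncated subtraction `h - 1` is the true one there. -/
noncomputable def stepWeight (α β q : ℝ) (h : ℕ) : Step → ℝ
  | .N => qInt q (h + 1)
  | .Ebar => qInt q h + q ^ h / α
  | .E => qInt q h + q ^ h / β
  | .S => qInt q h + q ^ h / (α * β) - q ^ (h - 1) * (1 / α - 1) * (1 / β - 1)

/-- The weight of a path: the product of the weights of its steps. -/
noncomputable def pathWeight {n : ℕ} (α β q : ℝ) (c : Fin n → Step) : ℝ :=
  ∏ i : Fin n, stepWeight α β q (height c i).toNat (c i)

/-- The configuration `θ(c)` of a path. -/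
def theta {n : ℕ} (c : Fin n → Step) : Config n := fun i => (c i).color

/-- `W(X)`: the total weight of the bicolored Motzkin paths `c` with `θ(c) = X`. -/
noncomputable def W {n : ℕ} (α β q : ℝ) (X : Config n) : ℝ :=
  ∑ c ∈ Finset.univ.filter (fun c : Fin n → Step => IsMotzkin c ∧ theta c = X),
    pathWeight α β q c

/-- `Z_n`: the sum of `W(X)` over all configurations. -/
noncomputable def Z (n : ℕ) (α β q : ℝ) : ℝ := ∑ X : Config n, W α β q X

/-! ### The `q`-Eulerian numbers -/

open LaurentPolynomial in
/-- `Ê_{k,n}(q)` as a Laurent polynomial in `q`: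
`q^(k-k²) ∑_{i=0}^{k-1} (-1)^i [k-i]_q^n q^(k(i-1)) (C(n,i) q^(k-i) + C(n,i-1))`,
with `C(n,-1) = 0`. -/
noncomputable def qEulerian (k n : ℕ) : LaurentPolynomial ℤ :=
  T ((k : ℤ) - (k : ℤ) ^ 2) *
    ∑ i ∈ Finset.range k,
      (-1) ^ i * qInt (T 1) (k - i) ^ n * T ((k : ℤ) * ((i : ℤ) - 1)) *
        ((n.choose i : LaurentPolynomial ℤ) * T ((k : ℤ) - (i : ℤ)) +
          (if i = 0 then 0 else (n.choose (i - 1) : LaurentPolynomial ℤ)))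

end PASEP

/-! At `α = β = 1` every step starting at height `h` has weight `[h+1]_q`, so the weight of a word
is a product of two operators on functions of the height, D for `•` and E for `∘`, applied to the
indicator of height 0 and read at height 0 (`W_eq_wordWeight`).

Stationarity is the matrix ansatz: DE = qED + D + E (`letterOp_true_false`), E fixes the evaluation
at 0 and D fixes the indicator of 0. Hence the net probability flow into `Y` through each bond is a
difference of two signed weights of `Y` with a cell removed, and these differences telescope against
the flows at the two ends (`wordWeight_stationary`). Uniqueness holds because every nonzero
nonnegative stationary vector charges the full configuration (`stationary_unique`,
`stationary_full_pos`).

For the particle count, let F_n(z) collect the total weights of words of length n, with y marking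
particles and z the starting height. Then F_{n+1} = T F_n with T f = D_q((1+z)(y+z) f), D_q the
q-derivative, and F_0 = 1 = T(1/(1+z)). With p = 1/q, T has the eigenfunctions ∏_{1≤j≤k}(y+q^j z) /
∏_{0≤j≤k+1}(1+p^j z), with eigenvalues [k+1]_q (1 - y p^{k+1}) (`motzkinOp_eigFun`). Expanding
1/(1+z) in them, with a remainder that T keeps of high order in y, gives F_n(0) modulo any power of
y (`motzkinSeries_expansion`); its coefficient of y^k is `qEulerian (k + 1) (n + 1)`.

This computation needs q invertible and different from 1, so it is made in Laurent polynomials. The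
weights themselves are polynomials in q with integer coefficients: this proves integrality, and
evaluating them covers every real q, including 0 and 1. -/

namespace PASEP

/-! ### Path weights at `α = β = 1` as products of operators -/

/-- The action of a letter at height `h` when all steps starting at height `h` have weight
`[h+1]_q`. -/
def letterOp {R : Type*} [Semiring R] (q : R) (b : Bool) (v : ℕ → R) (h : ℕ) : R :=
  qInt q (h + 1) * (v h + if b then v (h + 1) else if h = 0 then 0 else v (h - 1))

/-- The total weight of the paths from height `h` to height `0` that project to a given word. -/
def wordWeight {R : Type*} [Semiring R] (q : R) : {n : ℕ} → Config n → ℕ → R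
  | 0, _ => fun h => if h = 0 then 1 else 0
  | _ + 1, X => letterOp q (X 0) (wordWeight q (Fin.tail X))

theorem map_qInt {R S : Type*} [Semiring R] [Semiring S] (f : R →+* S) (q : R) (m : ℕ) :
    f (qInt q m) = qInt (f q) m := by
  simp [qInt]

/-- Transfers the weights from ℤ[q] both to Laurent polynomials, where they are computed, and to ℝ.
-/
theorem map_wordWeight {R S : Type*} [Semiring R] [Semiring S] (f : R →+* S) (q : R) {n : ℕ}
    (X : Config n) (h : ℕ) : f (wordWeight q X h) = wordWeight (f q) X h := by
  induction n generalizing h with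
  | zero => simp [wordWeight, apply_ite f]
  | succ n ih => simp [wordWeight, letterOp, map_qInt, apply_ite f, ih]

theorem qInt_succ' {R : Type*} [Semiring R] (q : R) (m : ℕ) :
    qInt q (m + 1) = qInt q m + q ^ m := Finset.sum_range_succ _ _

theorem stepWeight_one_one (q : ℝ) (h : ℕ) (s : Step) : stepWeight 1 1 q h s = qInt q (h + 1) := by
  cases s <;> simp [stepWeight, qInt_succ']

theorem height_zero {n : ℕ} (c : Fin n → Step) : height c 0 = 0 := by simp [height]

theorem height_cons {n : ℕ} (s : Step) (c : Fin n → Step) (i : ℕ) :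
    height (Fin.cons s c : Fin (n + 1) → Step) (i + 1) = s.rise + height c i := by
  simp [height, Finset.sum_filter, Fin.sum_univ_succ]

/-- The weight of the paths over `X` that start at height `a`, stay weakly above `0` and end at
`0`. -/
noncomputable def pathSum (q : ℝ) {n : ℕ} (a : ℤ) (X : Config n) : ℝ :=
  ∑ c : Fin n → Step,
    if ((∀ i ≤ n, 0 ≤ a + height c i) ∧ a + height c n = 0) ∧ theta c = X then
      ∏ i : Fin n, qInt q ((a + height c i).toNat + 1) else 0

/-- Lets the step `S` from height 0 enter the recursion like any other step: its contribution
vanishes because the empty prefix is already below 0. -/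
theorem pathSum_of_neg (q : ℝ) {n : ℕ} {a : ℤ} (ha : a < 0) (X : Config n) :
    pathSum q a X = 0 := by
  refine Finset.sum_eq_zero fun c _ => if_neg fun h => ?_
  have := h.1.1 0 (Nat.zero_le _)
  rw [height_zero] at this
  omega

theorem theta_cons_eq_iff {n : ℕ} (s : Step) (c : Fin n → Step) (X : Config (n + 1)) :
    theta (Fin.cons s c : Fin (n + 1) → Step) = X ↔ s.color = X 0 ∧ theta c = Fin.tail X := by
  constructor
  · rintro rfl
    exact ⟨rfl, rfl⟩
  · rintro ⟨h1, h2⟩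
    funext i
    refine Fin.cases h1 (fun i => ?_) i
    exact congrFun h2 i

theorem valid_cons_iff {n : ℕ} {a : ℤ} (ha : 0 ≤ a) (s : Step) (c : Fin n → Step) :
    ((∀ i ≤ n + 1, 0 ≤ a + height (Fin.cons s c : Fin (n + 1) → Step) i) ∧
      a + height (Fin.cons s c : Fin (n + 1) → Step) (n + 1) = 0) ↔
    (∀ i ≤ n, 0 ≤ a + s.rise + height c i) ∧ a + s.rise + height c n = 0 := by
  rw [height_cons, add_assoc]
  refine and_congr_left fun _ => ⟨fun h i hi => ?_, fun h i hi => ?_⟩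
  · have := h (i + 1) (by omega)
    rw [height_cons] at this
    omega
  · cases i with
    | zero => rw [height_zero]; omega
    | succ i => rw [height_cons]; have := h i (by omega); omega

theorem pathSum_succ (q : ℝ) {n : ℕ} {a : ℤ} (ha : 0 ≤ a) (X : Config (n + 1)) :
    pathSum q a X = ∑ s : Step, if s.color = X 0 then
      qInt q (a.toNat + 1) * pathSum q (a + s.rise) (Fin.tail X) else 0 := by
  rw [pathSum, ← (Fin.consEquiv fun _ => Step).sum_comp, Fintype.sum_prod_type]
  refine Finset.sum_congr rfl fun s _ => ?_
  have key (c : Fin n → Step) : (Fin.consEquiv fun _ => Step) (s, c) = Fin.cons s c := rfl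
  by_cases hs : s.color = X 0
  · rw [if_pos hs, pathSum, Finset.mul_sum]
    refine Finset.sum_congr rfl fun c _ => ?_
    rw [mul_ite, mul_zero]
    refine if_congr ?_ ?_ rfl
    · rw [key, valid_cons_iff ha, theta_cons_eq_iff]
      simp [hs]
    · simp only [key, Fin.prod_univ_succ, Fin.val_zero, height_zero, Fin.val_succ, height_cons,
        add_zero, add_assoc]
  · rw [if_neg hs]
    refine Finset.sum_eq_zero fun c _ => if_neg fun h => hs ?_
    rw [key, theta_cons_eq_iff] at h
    exact h.2.1

theorem sum_step {M : Type*} [AddCommMonoid M] (f : Step → M) :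
    ∑ s, f s = f .N + (f .E + (f .Ebar + f .S)) := by
  change ∑ s ∈ {.N, .E, .Ebar, .S}, f s = _
  rw [Finset.sum_insert (by simp), Finset.sum_insert (by simp), Finset.sum_insert (by simp),
    Finset.sum_singleton]

theorem pathSum_eq_wordWeight (q : ℝ) {n : ℕ} (X : Config n) (h : ℕ) :
    pathSum q h X = wordWeight q X h := by
  induction n generalizing h with
  | zero =>
    simp [pathSum, wordWeight, height, Subsingleton.elim _ X]
  | succ n ih =>
    rw [pathSum_succ q (Int.natCast_nonneg h), sum_step]
    have hN : pathSum q ((h : ℤ) + 1) (Fin.tail X) = wordWeight q (Fin.tail X) (h + 1) := by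
      rw [← ih]; simp
    have hS : pathSum q ((h : ℤ) + -1) (Fin.tail X) =
        if h = 0 then 0 else wordWeight q (Fin.tail X) (h - 1) := by
      split_ifs with h0
      · exact pathSum_of_neg q (by omega) _
      · rw [← ih]; congr 1; omega
    simp only [Step.rise, Step.color, hN, hS, add_zero, ih, wordWeight, letterOp, Int.toNat_natCast]
    cases X 0 <;> simp [mul_add, add_comm]

theorem W_eq_wordWeight (q : ℝ) {n : ℕ} (X : Config n) : W 1 1 q X = wordWeight q X 0 := by
  rw [← pathSum_eq_wordWeight, W, Finset.sum_filter, pathSum]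
  simp [IsMotzkin, pathWeight, stepWeight_one_one]

theorem wordWeight_nonneg {q : ℝ} (hq : 0 ≤ q) {n : ℕ} (X : Config n) (h : ℕ) :
    0 ≤ wordWeight q X h := by
  induction n generalizing h with
  | zero => simp only [wordWeight]; positivity
  | succ n ih =>
    have hi : 0 ≤ qInt q (h + 1) := Finset.sum_nonneg fun i _ => by positivity
    refine mul_nonneg hi (add_nonneg (ih _ _) ?_)
    split_ifs
    exacts [ih _ _, le_rfl, ih _ _]

/-- The path with level steps only stays at height 0, where each step has weight `[1]_q = 1`. -/
theorem wordWeight_zero_pos {q : ℝ} (hq : 0 ≤ q) {n : ℕ} (X : Config n) :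
    0 < wordWeight q X 0 := by
  induction n with
  | zero => simp [wordWeight]
  | succ n ih =>
    have hi : 0 < qInt q (0 + 1) := by simp [qInt]
    refine mul_pos hi (add_pos_of_pos_of_nonneg (ih _) ?_)
    rw [if_pos rfl]
    split_ifs
    exacts [wordWeight_nonneg hq _ _, le_rfl]

theorem Z_pos {q : ℝ} (hq : 0 ≤ q) (n : ℕ) : 0 < Z n 1 1 q :=
  Finset.sum_pos (fun X _ => by rw [W_eq_wordWeight]; exact wordWeight_zero_pos hq X)
    Finset.univ_nonempty

/-! ### The matrix ansatz -/

theorem qInt_succ_mul {R : Type*} [Semiring R] (q : R) (m : ℕ) :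
    qInt q (m + 1) = 1 + q * qInt q m := by
  simp [qInt, Finset.sum_range_succ', Finset.mul_sum, pow_succ', add_comm]

theorem letterOp_add {R : Type*} [CommSemiring R] (q : R) (b : Bool) (v w : ℕ → R) (h : ℕ) :
    letterOp q b (fun h => v h + w h) h = letterOp q b v h + letterOp q b w h := by
  unfold letterOp
  split_ifs <;> ring

theorem letterOp_mul {R : Type*} [CommSemiring R] (q a : R) (b : Bool) (v : ℕ → R) (h : ℕ) :
    letterOp q b (fun h => a * v h) h = a * letterOp q b v h := by
  unfold letterOp
  split_ifs <;> ring

/-- Comparing the coefficients of `v (h - 1)`, `v h` and `v (h + 1)`, everything reduces to `[m+1]_q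
= 1 + q [m]_q`. The boundary case `h = 0` agrees because `[0]_q = 0`. -/
theorem letterOp_true_false {R : Type*} [CommSemiring R] (q : R) (v : ℕ → R) (h : ℕ) :
    letterOp q true (letterOp q false v) h =
      q * letterOp q false (letterOp q true v) h + (letterOp q true v h + letterOp q false v h) := by
  cases h with
  | zero => simp [letterOp, qInt_succ_mul]; simp [qInt]; ring
  | succ h =>
    simp [letterOp]
    rw [qInt_succ_mul q (h + 2), qInt_succ_mul q (h + 1)]
    ring

theorem wordWeight_false_zero {R : Type*} [CommSemiring R] (q : R) {n : ℕ} (X : Config (n + 1))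
    (hX : X 0 = false) : wordWeight q X 0 = wordWeight q (Fin.tail X) 0 := by
  simp [wordWeight, letterOp, hX, qInt]

theorem wordWeight_last_true {R : Type*} [CommSemiring R] (q : R) {n : ℕ} (X : Config (n + 1))
    (hX : X (Fin.last n) = true) (h : ℕ) : wordWeight q X h = wordWeight q (Fin.init X) h := by
  induction n generalizing h with
  | zero =>
    have : X 0 = true := hX
    simp only [wordWeight, letterOp, this]
    cases h <;> simp [qInt]
  | succ n ih =>
    exact congrArg (fun v => letterOp q (X 0) v h) (funext fun h => ih (Fin.tail X) hX h)

/-- The configuration with the contents of the cells `i` and `i + 1` exchanged. -/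
def swapAt {m : ℕ} (i : Fin m) (X : Config (m + 1)) : Config (m + 1) :=
  fun j => X (Equiv.swap i.castSucc i.succ j)

theorem tail_swapAt_succ {m : ℕ} (i : Fin m) (X : Config (m + 2)) :
    Fin.tail (swapAt i.succ X) = swapAt i (Fin.tail X) := by
  funext j
  simp only [Fin.tail, swapAt]
  congr 1
  rw [← Fin.succ_castSucc, (Fin.succ_injective _).swap_apply]

theorem tail_removeNth_succ {m : ℕ} (i : Fin (m + 1)) (X : Config (m + 2)) :
    Fin.tail (i.succ.removeNth X) = i.removeNth (Fin.tail X) := by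
  funext j
  simp [Fin.tail, Fin.removeNth]

/-- The relation DE = qED + D + E inside a word: the letters before the bond act linearly and are
peeled off by induction. Removing cell `i + 1` leaves D, removing cell `i` leaves E. -/
theorem wordWeight_true_false {R : Type*} [CommSemiring R] (q : R) {m : ℕ} (X : Config (m + 1))
    (i : Fin m) (h1 : X i.castSucc = true) (h0 : X i.succ = false) (h : ℕ) :
    wordWeight q X h = q * wordWeight q (swapAt i X) h +
      (wordWeight q (i.succ.removeNth X) h + wordWeight q (i.castSucc.removeNth X) h) := by
  induction m generalizing h with
  | zero => exact i.elim0
  | succ m ih =>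
    induction i using Fin.cases with
    | zero =>
      have h1' : X 0 = true := h1
      have h0' : X 1 = false := h0
      have e1 : swapAt 0 X 0 = false := by simpa [swapAt] using h0'
      have e2 : swapAt 0 X 1 = true := by simpa [swapAt] using h1'
      have e3 : Fin.tail (Fin.tail (swapAt 0 X)) = Fin.tail (Fin.tail X) := by
        funext j
        simp only [Fin.tail, swapAt]
        congr 1
      have e4 : Fin.tail ((Fin.succ 0).removeNth X) = Fin.tail (Fin.tail X) := by
        rw [tail_removeNth_succ, Fin.removeNth_zero]
      have e5 : (Fin.castSucc 0).removeNth X = Fin.tail X := by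
        rw [Fin.castSucc_zero, Fin.removeNth_zero]
      have e6 : (Fin.succ 0).removeNth X 0 = true := h1
      rw [e5]
      simp only [wordWeight]
      rw [e3, e4, e1, e6, h1']
      simp only [Fin.tail, Fin.succ_zero_eq_one, e2, h0']
      exact letterOp_true_false q _ h
    | succ i =>
      have key := fun h => ih (Fin.tail X) i h1 h0 h
      have e0 : swapAt i.succ X 0 = X 0 := by
        simp only [swapAt]
        congr 1
      have e1 : i.succ.succ.removeNth X 0 = X 0 := by
        simp [Fin.removeNth]
      have e2 : i.succ.castSucc.removeNth X 0 = X 0 := by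
        simp [Fin.removeNth]
      simp only [wordWeight]
      rw [e0, e1, e2, tail_swapAt_succ, tail_removeNth_succ, ← Fin.succ_castSucc,
        tail_removeNth_succ, ← letterOp_mul, ← letterOp_add, ← letterOp_add]
      congr 1
      funext h
      exact key h

/-! ### The transition rates -/

/-- A particle in the cell `i` hops to the empty cell `i + 1`. -/
def HopAt {m : ℕ} (i : Fin m) (X Y : Config (m + 1)) : Prop :=
  X i.castSucc = true ∧ X i.succ = false ∧ Y = swapAt i X

instance {m : ℕ} (i : Fin m) (X Y : Config (m + 1)) : Decidable (HopAt i X Y) := by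
  unfold HopAt; infer_instance

/-- A particle enters at the leftmost cell. -/
def Enters {m : ℕ} (X Y : Config (m + 1)) : Prop :=
  X 0 = false ∧ Y = Function.update X 0 true

instance {m : ℕ} (X Y : Config (m + 1)) : Decidable (Enters X Y) := by
  unfold Enters; infer_instance

/-- A particle exits from the rightmost cell. -/
def Exits {m : ℕ} (X Y : Config (m + 1)) : Prop :=
  X (Fin.last m) = true ∧ Y = Function.update X (Fin.last m) false

instance {m : ℕ} (X Y : Config (m + 1)) : Decidable (Exits X Y) := by
  unfold Exits; infer_instance

theorem swapAt_castSucc {m : ℕ} (i : Fin m) (X : Config (m + 1)) :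
    swapAt i X i.castSucc = X i.succ := by
  simp [swapAt]

theorem swapAt_succ {m : ℕ} (i : Fin m) (X : Config (m + 1)) :
    swapAt i X i.succ = X i.castSucc := by
  simp [swapAt]

theorem swapAt_of_ne {m : ℕ} {i : Fin m} {j : Fin (m + 1)} (X : Config (m + 1))
    (h : j ≠ i.castSucc) (h' : j ≠ i.succ) : swapAt i X j = X j := by
  simp [swapAt, Equiv.swap_apply_of_ne_of_ne h h']

theorem swapAt_swapAt {m : ℕ} (i : Fin m) (X : Config (m + 1)) : swapAt i (swapAt i X) = X := by
  funext j
  simp [swapAt]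

theorem update_update_eq_swapAt {m : ℕ} {i : Fin m} {X : Config (m + 1)}
    (h1 : X i.castSucc = true) (h0 : X i.succ = false) :
    Function.update (Function.update X i.castSucc false) i.succ true = swapAt i X := by
  funext j
  by_cases hj : j = i.succ
  · subst hj
    rw [swapAt_succ, h1, Function.update_self]
  · rw [Function.update_of_ne hj]
    by_cases hj' : j = i.castSucc
    · subst hj'
      rw [swapAt_castSucc, h0, Function.update_self]
    · rw [Function.update_of_ne hj', swapAt_of_ne X hj' hj]

theorem isHop_iff {m : ℕ} (X Y : Config (m + 1)) : IsHop X Y ↔ ∃ i : Fin m, HopAt i X Y := by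
  constructor
  · rintro ⟨i, j, hij, h1, h0, rfl⟩
    obtain ⟨k, rfl⟩ : ∃ k : Fin m, k.castSucc = i := ⟨⟨i, by omega⟩, rfl⟩
    obtain rfl : k.succ = j := Fin.ext (by simpa using hij)
    exact ⟨k, h1, h0, update_update_eq_swapAt h1 h0⟩
  · rintro ⟨i, h1, h0, rfl⟩
    exact ⟨i.castSucc, i.succ, by simp, h1, h0, (update_update_eq_swapAt h1 h0).symm⟩

theorem isEntry_iff {m : ℕ} (X Y : Config (m + 1)) : IsEntry X Y ↔ Enters X Y := by
  constructor
  · rintro ⟨i, hi, h⟩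
    obtain rfl : i = 0 := Fin.ext hi
    exact h
  · exact fun h => ⟨0, rfl, h⟩

theorem isExit_iff {m : ℕ} (X Y : Config (m + 1)) : IsExit X Y ↔ Exits X Y := by
  constructor
  · rintro ⟨i, hi, h⟩
    obtain rfl : i = Fin.last m := Fin.ext (by simpa using hi)
    exact h
  · exact fun h => ⟨Fin.last m, by simp, h⟩

/-- The cells emptied and filled by a move identify it: a hop empties one cell and fills the next,
an entry empties none, an exit fills none. The exclusions below follow, and they turn the nested
cases of `jump` into the sum `rate`. -/
theorem HopAt.loss {m : ℕ} {i : Fin m} {X Y : Config (m + 1)} (h : HopAt i X Y) (j : Fin (m + 1)) :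
    X j = true ∧ Y j = false ↔ j = i.castSucc := by
  obtain ⟨h1, h0, rfl⟩ := h
  constructor
  · rintro ⟨h2, h3⟩
    by_contra hj
    by_cases hj' : j = i.succ
    · subst hj'; simp_all
    · rw [swapAt_of_ne X hj hj'] at h3; simp_all
  · rintro rfl
    rw [swapAt_castSucc]
    exact ⟨h1, h0⟩

theorem HopAt.gain {m : ℕ} {i : Fin m} {X Y : Config (m + 1)} (h : HopAt i X Y) (j : Fin (m + 1)) :
    X j = false ∧ Y j = true ↔ j = i.succ := by
  obtain ⟨h1, h0, rfl⟩ := h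
  constructor
  · rintro ⟨h2, h3⟩
    by_contra hj
    by_cases hj' : j = i.castSucc
    · subst hj'; simp_all
    · rw [swapAt_of_ne X hj' hj] at h3; simp_all
  · rintro rfl
    rw [swapAt_succ]
    exact ⟨h0, h1⟩

theorem Enters.not_loss {m : ℕ} {X Y : Config (m + 1)} (h : Enters X Y) (j : Fin (m + 1)) :
    ¬ (X j = true ∧ Y j = false) := by
  obtain ⟨h1, rfl⟩ := h
  rintro ⟨h2, h3⟩
  by_cases hj : j = 0
  · subst hj; simp_all
  · rw [Function.update_of_ne hj] at h3; simp_all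

theorem Enters.gain {m : ℕ} {X Y : Config (m + 1)} (h : Enters X Y) :
    X 0 = false ∧ Y 0 = true := by
  obtain ⟨h1, rfl⟩ := h
  simp [h1]

theorem Exits.not_gain {m : ℕ} {X Y : Config (m + 1)} (h : Exits X Y) (j : Fin (m + 1)) :
    ¬ (X j = false ∧ Y j = true) := by
  obtain ⟨h1, rfl⟩ := h
  rintro ⟨h2, h3⟩
  by_cases hj : j = Fin.last m
  · subst hj; simp_all
  · rw [Function.update_of_ne hj] at h3; simp_all

theorem HopAt.unique {m : ℕ} {i j : Fin m} {X Y : Config (m + 1)} (h : HopAt i X Y)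
    (h' : HopAt j X Y) : i = j :=
  Fin.castSucc_injective _ <| (h'.loss _).1 ((h.loss _).2 rfl)

theorem HopAt.not_symm {m : ℕ} {i j : Fin m} {X Y : Config (m + 1)} (h : HopAt i X Y) :
    ¬ HopAt j Y X := by
  intro h'
  have h1 := (h'.gain _).1 ((h.loss _).2 rfl).symm
  have h2 := (h'.loss _).1 ((h.gain _).2 rfl).symm
  rw [Fin.ext_iff] at h1 h2
  simp at h1 h2
  omega

theorem HopAt.not_enters {m : ℕ} {i : Fin m} {X Y : Config (m + 1)} (h : HopAt i X Y) :
    ¬ Enters X Y := fun h' => h'.not_loss _ ((h.loss _).2 rfl)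

theorem HopAt.not_enters' {m : ℕ} {i : Fin m} {X Y : Config (m + 1)} (h : HopAt i Y X) :
    ¬ Enters X Y := fun h' => h'.not_loss _ ((h.gain _).2 rfl).symm

theorem HopAt.not_exits {m : ℕ} {i : Fin m} {X Y : Config (m + 1)} (h : HopAt i X Y) :
    ¬ Exits X Y := fun h' => h'.not_gain _ ((h.gain _).2 rfl)

theorem HopAt.not_exits' {m : ℕ} {i : Fin m} {X Y : Config (m + 1)} (h : HopAt i Y X) :
    ¬ Exits X Y := fun h' => h'.not_gain _ ((h.loss _).2 rfl).symm

theorem Enters.not_exits {m : ℕ} {X Y : Config (m + 1)} (h : Enters X Y) : ¬ Exits X Y :=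
  fun h' => h'.not_gain _ h.gain

/-- The jump rate from `X` to `Y`, as a sum over the possible places of a jump. -/
noncomputable def rate {m : ℕ} (q : ℝ) (X Y : Config (m + 1)) : ℝ :=
  ∑ i : Fin m, ((if HopAt i X Y then 1 else 0) + (if HopAt i Y X then q else 0)) +
    (if Enters X Y then 1 else 0) + (if Exits X Y then 1 else 0)

theorem sum_ite_hopAt {m : ℕ} (X Y : Config (m + 1)) (a : ℝ) :
    ∑ i : Fin m, (if HopAt i X Y then a else 0) = if IsHop X Y then a else 0 := by
  split_ifs with h
  · obtain ⟨i, hi⟩ := (isHop_iff X Y).1 h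
    rw [Finset.sum_eq_single i (fun j _ hj => if_neg fun hj' => hj (hj'.unique hi)) (by simp),
      if_pos hi]
  · exact Finset.sum_eq_zero fun i _ => if_neg fun hi => h ((isHop_iff X Y).2 ⟨i, hi⟩)

theorem jump_eq_rate {m : ℕ} (q : ℝ) (X Y : Config (m + 1)) :
    jump 1 1 q X Y = rate q X Y / ((m + 1 : ℕ) + 1) := by
  rw [jump, rate, Finset.sum_add_distrib, sum_ite_hopAt, sum_ite_hopAt]
  simp only [isEntry_iff, isExit_iff]
  by_cases h1 : IsHop X Y
  · obtain ⟨i, hi⟩ := (isHop_iff X Y).1 h1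
    have h2 : ¬ IsHop Y X := fun h => by
      obtain ⟨j, hj⟩ := (isHop_iff Y X).1 h
      exact hi.not_symm hj
    simp [h1, h2, hi.not_enters, hi.not_exits]
  · by_cases h2 : IsHop Y X
    · obtain ⟨i, hi⟩ := (isHop_iff Y X).1 h2
      simp [h1, h2, hi.not_enters', hi.not_exits']
    · by_cases h3 : Enters X Y
      · simp [h1, h2, h3, h3.not_exits]
      · by_cases h4 : Exits X Y <;> simp [h1, h2, h3, h4]

theorem hopAt_iff_left {m : ℕ} (i : Fin m) (X Y : Config (m + 1)) :
    HopAt i X Y ↔ (Y i.castSucc = false ∧ Y i.succ = true) ∧ X = swapAt i Y := by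
  constructor
  · rintro ⟨h1, h0, rfl⟩
    rw [swapAt_castSucc, swapAt_succ, swapAt_swapAt]
    exact ⟨⟨h0, h1⟩, rfl⟩
  · rintro ⟨⟨h0, h1⟩, rfl⟩
    rw [HopAt, swapAt_castSucc, swapAt_succ, swapAt_swapAt]
    exact ⟨h1, h0, rfl⟩

theorem hopAt_iff_right {m : ℕ} (i : Fin m) (X Y : Config (m + 1)) :
    HopAt i X Y ↔ (X i.castSucc = true ∧ X i.succ = false) ∧ Y = swapAt i X := by
  rw [HopAt, and_assoc]

theorem update_iff {m : ℕ} (i : Fin (m + 1)) (b : Bool) (X Y : Config (m + 1)) :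
    X i = b ∧ Y = Function.update X i (!b) ↔ Y i = !b ∧ X = Function.update Y i b := by
  constructor
  · rintro ⟨rfl, rfl⟩
    simp
  · rintro ⟨h, rfl⟩
    simp [← h]

theorem sum_ite_and_eq {S : Type*} [Fintype S] [DecidableEq S] (p : Prop) [Decidable p] (Y : S)
    (f : S → ℝ) (a : ℝ) :
    ∑ X, f X * (if p ∧ X = Y then a else 0) = if p then f Y * a else 0 := by
  by_cases hp : p <;> simp [hp]

theorem sum_mul_rate {m : ℕ} (q : ℝ) (f : Config (m + 1) → ℝ) (Y : Config (m + 1)) :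
    ∑ X, f X * rate q X Y =
      ∑ i : Fin m, ((if Y i.castSucc = false ∧ Y i.succ = true then f (swapAt i Y) else 0) +
        (if Y i.castSucc = true ∧ Y i.succ = false then f (swapAt i Y) * q else 0)) +
      (if Y 0 = true then f (Function.update Y 0 false) else 0) +
      (if Y (Fin.last m) = false then f (Function.update Y (Fin.last m) true) else 0) := by
  have h3 (X) : Enters X Y ↔ Y 0 = true ∧ X = Function.update Y 0 false := update_iff 0 false X Y
  have h4 (X) : Exits X Y ↔ Y (Fin.last m) = false ∧ X = Function.update Y (Fin.last m) true :=
    update_iff _ true X Y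
  simp only [rate, mul_add, Finset.sum_add_distrib, Finset.mul_sum]
  congr 1
  · congr 1
    · congr 1
      · rw [Finset.sum_comm]
        refine Finset.sum_congr rfl fun i _ => ?_
        simp only [hopAt_iff_left i _ Y, sum_ite_and_eq, mul_one]
      · rw [Finset.sum_comm]
        refine Finset.sum_congr rfl fun i _ => ?_
        simp only [hopAt_iff_right i Y, sum_ite_and_eq]
    · simp only [h3, sum_ite_and_eq, mul_one]
  · simp only [h4, sum_ite_and_eq, mul_one]

theorem sum_rate {m : ℕ} (q : ℝ) (X : Config (m + 1)) :
    ∑ Y, rate q X Y =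
      ∑ i : Fin m, ((if X i.castSucc = true ∧ X i.succ = false then 1 else 0) +
        (if X i.castSucc = false ∧ X i.succ = true then q else 0)) +
      (if X 0 = false then 1 else 0) + (if X (Fin.last m) = true then 1 else 0) := by
  have key (p : Prop) [Decidable p] (Y : Config (m + 1)) (a : ℝ) :
      ∑ X, (if p ∧ X = Y then a else 0) = if p then a else 0 := by
    simpa using sum_ite_and_eq p Y (fun _ => 1) a
  simp only [rate, Finset.sum_add_distrib]
  congr 1
  · congr 1
    · congr 1
      · rw [Finset.sum_comm]
        refine Finset.sum_congr rfl fun i _ => ?_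
        simp only [hopAt_iff_right i X, key]
      · rw [Finset.sum_comm]
        refine Finset.sum_congr rfl fun i _ => ?_
        simp only [hopAt_iff_left i _ X, key]
    · simp only [Enters, key]
  · simp only [Exits, key]

theorem rate_nonneg {m : ℕ} {q : ℝ} (hq : 0 ≤ q) (X Y : Config (m + 1)) : 0 ≤ rate q X Y := by
  unfold rate; positivity

theorem rate_self {m : ℕ} (q : ℝ) (X : Config (m + 1)) : rate q X X = 0 := by
  have h1 (i : Fin m) : ¬ HopAt i X X := fun h => h.not_symm h
  have h2 : ¬ Enters X X := fun h => by simpa [h.1] using congrFun h.2 0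
  have h3 : ¬ Exits X X := fun h => by simpa [h.1] using congrFun h.2 (Fin.last m)
  simp [rate, h1, h2, h3]

/-- Each of the `m` bonds allows at most one move, of rate at most 1, and each end contributes at
most 1. This makes the diagonal of the transition matrix nonnegative. -/
theorem sum_rate_le {m : ℕ} {q : ℝ} (hq : q ≤ 1) (X : Config (m + 1)) :
    ∑ Y, rate q X Y ≤ (m + 1 : ℕ) + 1 := by
  rw [sum_rate]
  have h1 : ∑ i : Fin m, ((if X i.castSucc = true ∧ X i.succ = false then (1 : ℝ) else 0) +
      (if X i.castSucc = false ∧ X i.succ = true then q else 0)) ≤ ∑ i : Fin m, 1 := by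
    refine Finset.sum_le_sum fun i _ => ?_
    cases X i.castSucc <;> cases X i.succ <;> simp [hq]
  have h2 : (if X 0 = false then (1 : ℝ) else 0) ≤ 1 := by split_ifs <;> simp
  have h3 : (if X (Fin.last m) = true then (1 : ℝ) else 0) ≤ 1 := by split_ifs <;> simp
  simp at h1
  push_cast
  linarith

theorem transitionMatrix_eq {m : ℕ} (q : ℝ) (X Y : Config (m + 1)) :
    transitionMatrix (m + 1) 1 1 q X Y =
      (if X = Y then 1 - (∑ Y', rate q X Y') / ((m + 1 : ℕ) + 1) else 0) +
        rate q X Y / ((m + 1 : ℕ) + 1) := by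
  rw [transitionMatrix]
  split_ifs with h
  · subst h
    rw [rate_self, zero_div, add_zero, Finset.sum_div]
    simp only [jump_eq_rate]
    congr 1
    refine Finset.sum_subset (Finset.filter_subset _ _) fun Y _ hY => ?_
    simp only [Finset.mem_filter, Finset.mem_univ, true_and, not_not] at hY
    rw [hY, rate_self, zero_div]
  · rw [jump_eq_rate, zero_add]

theorem transitionMatrix_nonneg {n : ℕ} {q : ℝ} (hq : 0 ≤ q) (hq1 : q ≤ 1) (X Y : Config n) :
    0 ≤ transitionMatrix n 1 1 q X Y := by
  cases n with
  | zero => simp [transitionMatrix, Subsingleton.elim X Y, Finset.filter_eq_empty_iff.2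
      fun Z _ => not_not.2 (Subsingleton.elim Z Y)]
  | succ m =>
    rw [transitionMatrix_eq]
    refine add_nonneg ?_ (div_nonneg (rate_nonneg hq _ _) (by positivity))
    split_ifs
    · rw [sub_nonneg]
      exact div_le_one_of_le₀ (sum_rate_le hq1 X) (by positivity)
    · rfl

theorem sum_transitionMatrix {n : ℕ} (q : ℝ) (X : Config n) :
    ∑ Y, transitionMatrix n 1 1 q X Y = 1 := by
  rw [← Finset.add_sum_erase _ _ (Finset.mem_univ X)]
  simp only [transitionMatrix, if_true]
  rw [Finset.sum_congr rfl (g := jump 1 1 q X) fun Y hY => if_neg (Finset.ne_of_mem_erase hY).symm,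
    Finset.filter_ne' Finset.univ X]
  ring

theorem vecMul_transitionMatrix_eq_iff {m : ℕ} (q : ℝ) (f : Config (m + 1) → ℝ) :
    Matrix.vecMul f (transitionMatrix (m + 1) 1 1 q) = f ↔
      ∀ Y, ∑ X, f X * rate q X Y = f Y * ∑ X, rate q Y X := by
  rw [funext_iff]
  refine forall_congr' fun Y => ?_
  have h0 : ((m + 1 : ℕ) : ℝ) + 1 ≠ 0 := by positivity
  simp only [Matrix.vecMul, dotProduct, transitionMatrix_eq, mul_add, Finset.sum_add_distrib,
    mul_ite, mul_zero, Finset.sum_ite_eq', Finset.mem_univ, if_true, mul_div_assoc', ← Finset.sum_div]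
  rw [← sub_eq_zero, ← sub_eq_zero (b := f Y * _)]
  have : f Y * (1 - (∑ X, rate q Y X) / ((m + 1 : ℕ) + 1)) +
      (∑ X, f X * rate q X Y) / ((m + 1 : ℕ) + 1) - f Y =
      (∑ X, f X * rate q X Y - f Y * ∑ X, rate q Y X) / ((m + 1 : ℕ) + 1) := by
    field_simp
    ring
  rw [this, div_eq_zero_iff, or_iff_left h0]

/-! ### Balance equations: flows through bonds and ends telescope -/

theorem succAbove_succ_castSucc_of_ne {m : ℕ} {i j : Fin m} (h : j ≠ i) :
    i.succ.succAbove j = i.castSucc.succAbove j := by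
  rcases lt_or_gt_of_ne h with h | h
  · rw [Fin.succAbove_of_castSucc_lt _ _ (Fin.castSucc_lt_castSucc_iff.2 h),
      Fin.succAbove_of_castSucc_lt _ _ ((Fin.castSucc_lt_castSucc_iff.2 h).trans i.castSucc_lt_succ)]
  · rw [Fin.succAbove_of_lt_succ _ _ (Fin.succ_lt_succ_iff.2 h),
      Fin.succAbove_of_lt_succ _ _ (i.castSucc_lt_succ.trans (Fin.succ_lt_succ_iff.2 h))]

theorem swapAt_succAbove_of_ne {m : ℕ} {i j : Fin m} (h : j ≠ i) (X : Config (m + 1)) :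
    swapAt i X (i.castSucc.succAbove j) = X (i.castSucc.succAbove j) := by
  refine swapAt_of_ne X (Fin.succAbove_ne _ _) fun h' => ?_
  rw [← succAbove_succ_castSucc_of_ne h] at h'
  exact Fin.succAbove_ne _ _ h'

theorem removeNth_succ_swapAt {m : ℕ} (i : Fin m) (X : Config (m + 1)) :
    i.succ.removeNth (swapAt i X) = i.castSucc.removeNth X := by
  funext j
  simp only [Fin.removeNth]
  by_cases hj : j = i
  · subst hj
    rw [Fin.succAbove_succ_self, Fin.succAbove_castSucc_self, swapAt_castSucc]
  · rw [succAbove_succ_castSucc_of_ne hj, swapAt_succAbove_of_ne hj]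

theorem removeNth_castSucc_swapAt {m : ℕ} (i : Fin m) (X : Config (m + 1)) :
    i.castSucc.removeNth (swapAt i X) = i.succ.removeNth X := by
  rw [← removeNth_succ_swapAt, swapAt_swapAt]

theorem removeNth_succ_eq_castSucc {m : ℕ} {i : Fin m} {X : Config (m + 1)}
    (h : X i.castSucc = X i.succ) : i.succ.removeNth X = i.castSucc.removeNth X := by
  rw [← removeNth_castSucc_swapAt]
  congr 1
  funext j
  by_cases hj : j = i.castSucc
  · rw [hj, swapAt_castSucc, h]
  · by_cases hj' : j = i.succ
    · rw [hj', swapAt_succ, h]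
    · rw [swapAt_of_ne X hj hj']

/-- The weight of `Y` with the cell `i` removed, with a sign telling what the cell contained. -/
noncomputable def signedRemove (q : ℝ) {m : ℕ} (Y : Config (m + 1)) (i : Fin (m + 1)) : ℝ :=
  (if Y i then 1 else -1) * wordWeight q (i.removeNth Y) 0

/-- If the two cells differ, this is `wordWeight_true_false`, for `Y` or for its swap. If they
agree, there is no flow, and removing either cell gives the same word. -/
theorem bond_flow (q : ℝ) {m : ℕ} (Y : Config (m + 1)) (i : Fin m) :
    ((if Y i.castSucc = false ∧ Y i.succ = true then wordWeight q (swapAt i Y) 0 else 0) +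
      (if Y i.castSucc = true ∧ Y i.succ = false then wordWeight q (swapAt i Y) 0 * q else 0)) -
    wordWeight q Y 0 * ((if Y i.castSucc = true ∧ Y i.succ = false then 1 else 0) +
      (if Y i.castSucc = false ∧ Y i.succ = true then q else 0)) =
    signedRemove q Y i.succ - signedRemove q Y i.castSucc := by
  unfold signedRemove
  cases h1 : Y i.castSucc <;> cases h2 : Y i.succ
  · rw [removeNth_succ_eq_castSucc (h1.trans h2.symm)]
    simp
  · have := wordWeight_true_false q (swapAt i Y) i (by rw [swapAt_castSucc, h2])
      (by rw [swapAt_succ, h1]) 0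
    rw [swapAt_swapAt, removeNth_castSucc_swapAt, removeNth_succ_swapAt] at this
    simp [this]
    ring
  · have := wordWeight_true_false q Y i h1 h2 0
    simp [this]
    ring
  · rw [removeNth_succ_eq_castSucc (h1.trans h2.symm)]
    simp

theorem left_flow (q : ℝ) {m : ℕ} (Y : Config (m + 1)) :
    (if Y 0 = true then wordWeight q (Function.update Y 0 false) 0 else 0) -
      wordWeight q Y 0 * (if Y 0 = false then 1 else 0) = signedRemove q Y 0 := by
  rw [signedRemove, Fin.removeNth_zero]
  cases h : Y 0
  · simp [wordWeight_false_zero q Y h]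
  · simp [wordWeight_false_zero q (Function.update Y 0 false) (by simp)]

theorem right_flow (q : ℝ) {m : ℕ} (Y : Config (m + 1)) :
    (if Y (Fin.last m) = false then wordWeight q (Function.update Y (Fin.last m) true) 0 else 0) -
      wordWeight q Y 0 * (if Y (Fin.last m) = true then 1 else 0) =
      -signedRemove q Y (Fin.last m) := by
  rw [signedRemove, Fin.removeNth_last]
  cases h : Y (Fin.last m)
  · simp [wordWeight_last_true q (Function.update Y (Fin.last m) true) (by simp)]
  · simp [wordWeight_last_true q Y h]

theorem wordWeight_stationary (q : ℝ) {n : ℕ} :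
    Matrix.vecMul (fun X : Config n => wordWeight q X 0) (transitionMatrix n 1 1 q) =
      fun X => wordWeight q X 0 := by
  cases n with
  | zero =>
    funext Y
    have := sum_transitionMatrix q Y
    simp [Matrix.vecMul, dotProduct, Subsingleton.elim _ Y, wordWeight] at this ⊢
    exact this
  | succ m =>
    rw [vecMul_transitionMatrix_eq_iff]
    intro Y
    rw [sum_mul_rate, sum_rate]
    have hb := Finset.sum_congr rfl fun i (_ : i ∈ Finset.univ) => bond_flow q Y i
    rw [Finset.sum_sub_distrib, Finset.sum_sub_distrib, ← Finset.mul_sum] at hb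
    -- The two ways of splitting off an end term of the same sum: this is the telescoping.
    have ht := (Fin.sum_univ_succ (signedRemove q Y)).symm.trans
      (Fin.sum_univ_castSucc (signedRemove q Y))
    have hl := left_flow q Y
    have hr := right_flow q Y
    linear_combination hb + ht + hl + hr

/-! ### Uniqueness of the stationary distribution -/

/-- Nonnegativity of `P` gives d⁺ ≤ d⁺P pointwise, and row sums 1 give both sides the same total
mass, so equality holds everywhere. -/
theorem vecMul_posPart_eq {S : Type*} [Fintype S] {P : Matrix S S ℝ} (hP : ∀ x y, 0 ≤ P x y)
    (hP1 : ∀ x, ∑ y, P x y = 1) {d : S → ℝ} (hd : Matrix.vecMul d P = d) :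
    Matrix.vecMul (fun x => max (d x) 0) P = fun x => max (d x) 0 := by
  have hle (y : S) : max (d y) 0 ≤ Matrix.vecMul (fun x => max (d x) 0) P y := by
    refine max_le ?_ (Finset.sum_nonneg fun x _ => mul_nonneg (le_max_right _ _) (hP x y))
    conv_lhs => rw [← hd]
    exact Finset.sum_le_sum fun x _ => mul_le_mul_of_nonneg_right (le_max_left _ _) (hP x y)
  have hsum : ∑ y, max (d y) 0 = ∑ y, Matrix.vecMul (fun x => max (d x) 0) P y := by
    simp only [Matrix.vecMul, dotProduct]
    rw [Finset.sum_comm]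
    simp [← Finset.mul_sum, hP1]
  funext y
  exact ((Finset.sum_eq_sum_iff_of_le fun y _ => hle y).1 hsum y (Finset.mem_univ y)).symm

/-- If the difference of two stationary distributions took both signs, its positive and negative
parts would both be positive at `s₀`, which is absurd. So it has one sign, and equal total mass
makes it zero. -/
theorem stationary_unique {S : Type*} [Fintype S] {P : Matrix S S ℝ} (hP : ∀ x y, 0 ≤ P x y)
    (hP1 : ∀ x, ∑ y, P x y = 1) (s₀ : S)
    (h₀ : ∀ μ : S → ℝ, (∀ x, 0 ≤ μ x) → Matrix.vecMul μ P = μ → (∃ x, 0 < μ x) → 0 < μ s₀)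
    {π π' : S → ℝ} (hπ : IsStationary P π) (hπ' : IsStationary P π') : π' = π := by
  have key (d : S → ℝ) (hd : Matrix.vecMul d P = d) (x : S) (hx : 0 < d x) : 0 < d s₀ := by
    have := h₀ _ (fun x => le_max_right (d x) 0) (vecMul_posPart_eq hP hP1 hd)
      ⟨x, lt_max_of_lt_left hx⟩
    simpa using this
  have nonpos {π π' : S → ℝ} (hπ : IsStationary P π) (hπ' : IsStationary P π') (x : S) :
      π x ≤ π' x := by
    by_contra! hx
    have hd : Matrix.vecMul (π - π') P = π - π' := by rw [Matrix.sub_vecMul, hπ.2, hπ'.2]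
    have hd' : Matrix.vecMul (π' - π) P = π' - π := by rw [Matrix.sub_vecMul, hπ.2, hπ'.2]
    have h1 := key _ hd x (sub_pos.2 hx)
    have h2 : ∀ y, π' y ≤ π y := fun y => by
      by_contra! hy
      have := key _ hd' y (sub_pos.2 hy)
      simp only [Pi.sub_apply] at h1 this
      linarith
    have := Finset.sum_lt_sum (fun y _ => h2 y) ⟨x, Finset.mem_univ x, hx⟩
    rw [hπ.1.2, hπ'.1.2] at this
    exact lt_irrefl _ this
  exact funext fun x => le_antisymm (nonpos hπ' hπ x) (nonpos hπ hπ' x)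

/-! ### Every stationary vector charges the full configuration -/

/-- The sum of the positions of the particles, counted from `1`. -/
def potential {n : ℕ} (X : Config n) : ℕ := ∑ i, if X i then (i : ℕ) + 1 else 0

theorem potential_swapAt {m : ℕ} {i : Fin m} {X : Config (m + 1)}
    (h1 : X i.castSucc = true) (h0 : X i.succ = false) :
    potential X < potential (swapAt i X) := by
  -- Reindexing by the swap keeps the particles of `X` and moves only their positions, so the sums
  -- compare termwise.
  have : potential (swapAt i X) =
      ∑ j : Fin (m + 1), if X j then (Equiv.swap i.castSucc i.succ j : ℕ) + 1 else 0 := by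
    rw [potential, ← Equiv.sum_comp (Equiv.swap i.castSucc i.succ)]
    simp [swapAt]
  rw [this]
  refine Finset.sum_lt_sum (fun j _ => ?_) ⟨i.castSucc, Finset.mem_univ _, by simp [h1]⟩
  by_cases hj : j = i.castSucc
  · subst hj; simp [h1]
  · by_cases hj' : j = i.succ
    · subst hj'; simp [h0]
    · rw [Equiv.swap_apply_of_ne_of_ne hj hj']

theorem potential_update_zero {m : ℕ} {X : Config (m + 1)} (h0 : X 0 = false) :
    potential X < potential (Function.update X 0 true) := by
  refine Finset.sum_lt_sum (fun j _ => ?_) ⟨0, Finset.mem_univ _, by simp [h0]⟩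
  by_cases hj : j = 0
  · subst hj; simp [h0]
  · rw [Function.update_of_ne hj]

/-- If the first cell is occupied and no `•∘` occurs, the configuration is full. Only entries and
forward hops, of rate 1, are used, so `q = 0` is allowed. -/
theorem exists_rate_pos {m : ℕ} {q : ℝ} (hq : 0 ≤ q) {X : Config (m + 1)}
    (hX : X ≠ fun _ => true) : ∃ Y, 0 < rate q X Y ∧ potential X < potential Y := by
  by_cases h0 : X 0 = false
  · refine ⟨_, ?_, potential_update_zero h0⟩
    have : Enters X (Function.update X 0 true) := ⟨h0, rfl⟩
    unfold rate
    rw [if_pos this]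
    positivity
  · obtain ⟨i, h1, h2⟩ : ∃ i : Fin m, X i.castSucc = true ∧ X i.succ = false := by
      by_contra! h
      refine hX (funext fun i => ?_)
      induction i using Fin.induction with
      | zero => simpa using h0
      | succ i ih => simpa using h i ih
    refine ⟨_, ?_, potential_swapAt h1 h2⟩
    have hop : HopAt i X (swapAt i X) := ⟨h1, h2, rfl⟩
    have : 0 < ∑ j : Fin m, ((if HopAt j X (swapAt i X) then (1 : ℝ) else 0) +
        (if HopAt j (swapAt i X) X then q else 0)) := by
      refine Finset.sum_pos' (fun _ _ => by positivity) ⟨i, Finset.mem_univ _, ?_⟩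
      rw [if_pos hop]
      positivity
    exact add_pos_of_pos_of_nonneg (add_pos_of_pos_of_nonneg this (by positivity)) (by positivity)

theorem stationary_full_pos {m : ℕ} {q : ℝ} (hq : 0 ≤ q) {μ : Config (m + 1) → ℝ}
    (hμ : ∀ X, 0 ≤ μ X) (hst : Matrix.vecMul μ (transitionMatrix (m + 1) 1 1 q) = μ)
    (hpos : ∃ X, 0 < μ X) : 0 < μ fun _ => true := by
  rw [vecMul_transitionMatrix_eq_iff] at hst
  -- A configuration of largest potential in the support must be full: otherwise a jump to a higher
  -- `Y` outside the support would give `Y` positive inflow and no outflow.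
  obtain ⟨X, hX, hmax⟩ := Finset.exists_max_image (Finset.univ.filter fun X => 0 < μ X) potential
    (by simpa [Finset.filter_nonempty_iff] using hpos)
  simp only [Finset.mem_filter, Finset.mem_univ, true_and] at hX hmax
  by_cases hfull : X = fun _ => true
  · rwa [← hfull]
  · obtain ⟨Y, hY, hlt⟩ := exists_rate_pos hq hfull
    refine absurd (hmax Y ?_) (not_le.2 hlt)
    refine (hμ Y).lt_of_ne fun h => ?_
    have h1 := hst Y
    rw [← h, zero_mul] at h1
    have h2 := (Finset.sum_eq_zero_iff_of_nonneg fun X _ =>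
      mul_nonneg (hμ X) (rate_nonneg hq X Y)).1 h1 X (Finset.mem_univ _)
    exact (mul_pos hX hY).ne' h2

theorem isStationary_wordWeight {q : ℝ} (hq : 0 ≤ q) (n : ℕ) :
    IsStationary (transitionMatrix n 1 1 q) fun X => wordWeight q X 0 / Z n 1 1 q := by
  have hZ := Z_pos hq n
  refine ⟨⟨fun X => div_nonneg (wordWeight_nonneg hq X 0) hZ.le, ?_⟩, ?_⟩
  · rw [← Finset.sum_div, div_eq_one_iff_eq hZ.ne', Z]
    simp only [W_eq_wordWeight]
  · have : (fun X : Config n => wordWeight q X 0 / Z n 1 1 q) =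
        (Z n 1 1 q)⁻¹ • fun X => wordWeight q X 0 := by
      funext X
      simp [div_eq_inv_mul]
    rw [this, Matrix.smul_vecMul, wordWeight_stationary]

theorem isStationary_unique {n : ℕ} {q : ℝ} (hq : 0 ≤ q) (hq1 : q ≤ 1) {π π' : Config n → ℝ}
    (hπ : IsStationary (transitionMatrix n 1 1 q) π)
    (hπ' : IsStationary (transitionMatrix n 1 1 q) π') : π' = π := by
  cases n with
  | zero =>
    have h1 := hπ.1.2
    have h2 := hπ'.1.2
    simp only [Finset.univ_unique, Finset.sum_singleton] at h1 h2
    funext X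
    rw [Subsingleton.elim X (@default _ Unique.instInhabited)]
    exact h2.trans h1.symm
  | succ m =>
    exact stationary_unique (transitionMatrix_nonneg hq hq1) (sum_transitionMatrix q) (fun _ => true)
      (fun μ h1 h2 h3 => stationary_full_pos hq h1 h2 h3) hπ hπ'

/-! ### The generating function of the weights -/

open PowerSeries in
/-- The `q`-derivative of a power series. -/
noncomputable def qDeriv {S : Type*} [CommRing S] (q : S) : PowerSeries S →ₗ[S] PowerSeries S where
  toFun f := PowerSeries.mk fun h => qInt q (h + 1) * coeff (h + 1) f
  map_add' f g := by ext h; simp [mul_add]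
  map_smul' a f := by ext h; simp [mul_left_comm]

open PowerSeries in
theorem coeff_qDeriv {S : Type*} [CommRing S] (q : S) (f : PowerSeries S) (h : ℕ) :
    coeff h (qDeriv q f) = qInt q (h + 1) * coeff (h + 1) f := by
  simp [qDeriv]

theorem one_sub_mul_qInt {S : Type*} [CommRing S] (q : S) (m : ℕ) :
    (1 - q) * qInt q m = 1 - q ^ m := mul_neg_geom_sum q m

open PowerSeries in
-- The formula D_q f(z) = (f(z) - f(qz)) / ((1-q)z) without division, which reduces the eigenvalue
-- computation to the substitution z ↦ qz.
theorem one_sub_mul_X_mul_qDeriv {S : Type*} [CommRing S] (q : S) (f : PowerSeries S) :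
    C (1 - q) * (X * qDeriv q f) = f - rescale q f := by
  ext h
  rw [coeff_C_mul, map_sub, coeff_rescale]
  cases h with
  | zero => simp
  | succ h => rw [coeff_succ_X_mul, coeff_qDeriv, ← mul_assoc, one_sub_mul_qInt]; ring

open PowerSeries in
/-- The operator on generating functions that appends a step at the beginning of a path, with a
weight `y` for each particle. -/
noncomputable def motzkinOp {S : Type*} [CommRing S] (q y : S) :
    PowerSeries S →ₗ[S] PowerSeries S :=
  qDeriv q ∘ₗ LinearMap.mulLeft S ((1 + X) * (C y + X))

open PowerSeries in
theorem motzkinOp_apply {S : Type*} [CommRing S] (q y : S) (f : PowerSeries S) :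
    motzkinOp q y f = qDeriv q ((1 + X) * (C y + X) * f) := rfl

open PowerSeries in
theorem coeff_motzkinOp {S : Type*} [CommRing S] (q y : S) (f : PowerSeries S) (h : ℕ) :
    coeff h (motzkinOp q y f) = qInt q (h + 1) *
      (y * (coeff h f + coeff (h + 1) f) +
        (coeff h f + if h = 0 then 0 else coeff (h - 1) f)) := by
  have : (1 + X) * (C y + X) * f = C y * f + (X * f + C y * (X * f)) + X * (X * f) := by
    ring
  rw [motzkinOp_apply, coeff_qDeriv, this]
  simp only [map_add, coeff_succ_X_mul, coeff_C_mul]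
  cases h with
  | zero => simp; ring
  | succ h => simp [coeff_succ_X_mul]; ring

/-- The generating function of the weights of the words of length `n` by number of particles and
starting height. -/
noncomputable def motzkinSeries {S : Type*} [CommRing S] (q y : S) (n : ℕ) : PowerSeries S :=
  PowerSeries.mk fun h => ∑ X : Config n, y ^ numParticles X * wordWeight q X h

theorem numParticles_cons {n : ℕ} (b : Bool) (X : Config n) :
    numParticles (Fin.cons b X : Config (n + 1)) = (if b then 1 else 0) + numParticles X := by
  simp only [numParticles, Finset.card_filter, Fin.sum_univ_succ, Fin.cons_zero, Fin.cons_succ]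

theorem motzkinSeries_zero {S : Type*} [CommRing S] (q y : S) : motzkinSeries q y 0 = 1 := by
  ext h
  simp [motzkinSeries, PowerSeries.coeff_one, wordWeight, numParticles]

theorem motzkinSeries_succ {S : Type*} [CommRing S] (q y : S) (n : ℕ) :
    motzkinSeries q y (n + 1) = motzkinOp q y (motzkinSeries q y n) := by
  ext h
  rw [coeff_motzkinOp]
  simp only [motzkinSeries, PowerSeries.coeff_mk]
  rw [← (Fin.consEquiv fun _ => Bool).sum_comp, Fintype.sum_prod_type]
  have key (b : Bool) (X : Config n) : (Fin.consEquiv fun _ => Bool) (b, X) = Fin.cons b X := rfl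
  simp only [key, Fintype.sum_bool, numParticles_cons, wordWeight, Fin.tail_cons, Fin.cons_zero,
    letterOp, if_true, Bool.false_eq_true, if_false, pow_add, pow_one, pow_zero]
  rw [mul_add]
  congr 1
  · rw [← Finset.sum_add_distrib, Finset.mul_sum, Finset.mul_sum]
    refine Finset.sum_congr rfl fun X _ => ?_
    ring
  · split_ifs
    · rw [add_zero, Finset.mul_sum]
      refine Finset.sum_congr rfl fun X _ => ?_
      ring
    · rw [← Finset.sum_add_distrib, Finset.mul_sum]
      refine Finset.sum_congr rfl fun X _ => ?_
      ring

theorem motzkinSeries_eq_pow {S : Type*} [CommRing S] (q y : S) (n : ℕ) :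
    motzkinSeries q y n = (motzkinOp q y ^ n) 1 := by
  induction n with
  | zero => rw [motzkinSeries_zero, pow_zero, Module.End.one_apply]
  | succ n ih => rw [motzkinSeries_succ, ih, pow_succ', Module.End.mul_apply]

/-! ### Eigenfunctions -/

section Eigen

open PowerSeries

variable {S : Type*} [CommRing S]

/-- The numerator `∏_{1≤j≤k} (y + q^j z)`. -/
noncomputable def eigNum (q y : S) (k : ℕ) : PowerSeries S :=
  ∏ j ∈ Finset.range k, (C y + C (q ^ (j + 1)) * X)

/-- The denominator `∏_{0≤j<k} (1 + p^j z)`. -/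
noncomputable def eigDen (p : S) (k : ℕ) : PowerSeries S :=
  ∏ j ∈ Finset.range k, (1 + C (p ^ j) * X)

theorem eigDen_mul_inv (p : S) (k : ℕ) : eigDen p k * invOfUnit (eigDen p k) 1 = 1 :=
  mul_invOfUnit _ _ (by simp [eigDen])

theorem isUnit_eigDen (p : S) (k : ℕ) : IsUnit (eigDen p k) :=
  IsUnit.of_mul_eq_one _ (eigDen_mul_inv p k)

/-- The eigenfunction `∏_{1≤j≤k} (y + q^j z) / ∏_{0≤j≤k+1} (1 + p^j z)`, where `p = 1/q`. -/
noncomputable def eigFun (q p y : S) (k : ℕ) : PowerSeries S :=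
  eigNum q y k * invOfUnit (eigDen p (k + 2)) 1

/-- The remainder of the expansion of `1 / (1 + z)` in eigenfunctions. -/
noncomputable def eigRem (q p y : S) (k : ℕ) : PowerSeries S :=
  C (p ^ (k * (k + 1))) * (eigNum q y k * invOfUnit (eigDen p (k + 1)) 1)

theorem eigDen_mul_eigFun (q p y : S) (k : ℕ) :
    eigDen p (k + 2) * eigFun q p y k = eigNum q y k := by
  rw [eigFun, mul_left_comm, eigDen_mul_inv, mul_one]

theorem eigDen_mul_eigRem (q p y : S) (k : ℕ) :
    eigDen p (k + 1) * eigRem q p y k = C (p ^ (k * (k + 1))) * eigNum q y k := by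
  rw [eigRem, mul_left_comm, mul_left_comm (eigDen p (k + 1)), eigDen_mul_inv, mul_one]

theorem rescale_C_mul_X' (q c : S) : rescale q (C c * X) = C q * (C c * X) := by
  ext h
  simp only [coeff_rescale, coeff_C_mul, coeff_X]
  split_ifs with h1
  · subst h1; ring
  · ring

theorem rescale_C' (q c : S) : rescale q (C c) = C c := by
  ext h
  rw [coeff_rescale, coeff_C]
  split_ifs with h1
  · subst h1; ring
  · ring

/-- Since pq = 1, the substitution z ↦ qz shifts the factors by one index: 1 + qz enters and 1 + p^k
z leaves. -/
theorem rescale_eigDen {q p : S} (hpq : p * q = 1) (k : ℕ) :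
    rescale q (eigDen p (k + 1)) * (1 + C (p ^ k) * X) = (1 + C q * X) * eigDen p (k + 1) := by
  rw [eigDen, map_prod, Finset.prod_range_succ', Finset.prod_range_succ]
  have (j : ℕ) : rescale q (1 + C (p ^ (j + 1)) * X) = 1 + C (p ^ j) * X := by
    rw [map_add, map_one, rescale_C_mul_X', ← mul_assoc, ← map_mul,
      show q * p ^ (j + 1) = p ^ j * (p * q) by ring, hpq, mul_one]
  simp only [this]
  rw [map_add, map_one, rescale_C_mul_X', pow_zero, map_one]
  ring

theorem rescale_eigNum (q y : S) (k : ℕ) :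
    (C y + C q * X) * rescale q (eigNum q y k) = eigNum q y k * (C y + C (q ^ (k + 1)) * X) := by
  have (j : ℕ) : rescale q (C y + C (q ^ (j + 1)) * X) = C y + C (q ^ (j + 1 + 1)) * X := by
    rw [map_add, rescale_C', rescale_C_mul_X', ← mul_assoc, ← map_mul, ← pow_succ']
  rw [eigNum, map_prod, ← Finset.prod_range_succ (fun j => C y + C (q ^ (j + 1)) * X),
    Finset.prod_range_succ']
  simp only [this, zero_add, pow_one]
  ring

theorem rescale_eigFun {q p : S} (hpq : p * q = 1) (y : S) (k : ℕ) :
    rescale q ((1 + X) * (C y + X) * eigFun q p y k) =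
      (1 + C (p ^ (k + 1)) * X) * (C y + C (q ^ (k + 1)) * X) * eigFun q p y k := by
  have hX : rescale q (X : PowerSeries S) = C q * X := by
    simp
  have h1 := rescale_eigDen hpq (k + 1)
  have h2 := rescale_eigNum q y k
  have h3 := congrArg (rescale q) (eigDen_mul_eigFun q p y k)
  have h4 := eigDen_mul_eigFun q p y k
  rw [map_mul] at h3
  have hu := isUnit_eigDen p (k + 2)
  refine hu.mul_left_cancel ((hu.map (rescale q)).mul_left_cancel ?_)
  simp only [map_mul, map_add, map_one, map_pow, hX, rescale_C'] at h1 h2 ⊢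
  linear_combination (1 + C q * X) * (C y + C q * X) * eigDen p (k + 2) * h3
    + (1 + C q * X) * eigDen p (k + 2) * h2
    - (C y + C q ^ (k + 1) * X) * eigNum q y k * h1
    - rescale q (eigDen p (k + 2)) * (1 + C p ^ (k + 1) * X) * (C y + C q ^ (k + 1) * X) * h4

/-- For g = (1+z)(y+z)f, `rescale_eigFun` gives g(qz) = (1+p^{k+1}z)(y+q^{k+1}z)f. In g(z) - g(qz)
the z² terms cancel, leaving z(1-q^{k+1})(1-yp^{k+1})f; then (1-q)z is cancelled. -/
theorem motzkinOp_eigFun [IsDomain S] {q p : S} (hpq : p * q = 1) (hq : q ≠ 1) (y : S) (k : ℕ) :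
    motzkinOp q y (eigFun q p y k) =
      (qInt q (k + 1) * (1 - y * p ^ (k + 1))) • eigFun q p y k := by
  have hq' : C (1 - q) ≠ (0 : PowerSeries S) := by
    rw [Ne, map_eq_zero_iff _ C_injective]
    exact sub_ne_zero.2 hq.symm
  refine mul_left_cancel₀ hq' (mul_left_cancel₀ (X_ne_zero : (X : PowerSeries S) ≠ 0) ?_)
  have h1 := one_sub_mul_X_mul_qDeriv q ((1 + X) * (C y + X) * eigFun q p y k)
  rw [rescale_eigFun hpq] at h1
  have h2 := congrArg (C (R := S)) (one_sub_mul_qInt q (k + 1))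
  have h3 : C p ^ (k + 1) * C q ^ (k + 1) = (1 : PowerSeries S) := by
    rw [← mul_pow, ← map_mul, hpq, map_one, one_pow]
  rw [motzkinOp_apply, smul_eq_C_mul]
  simp only [map_mul, map_sub, map_pow, map_one] at h1 h2 ⊢
  linear_combination h1 - X * (1 - C y * C p ^ (k + 1)) * eigFun q p y k * h2
    + (-X ^ 2 - C y * X) * eigFun q p y k * h3

/-- Over the common denominator the factor 1 + p^{k+1}z - p^{2(k+1)}(y + q^{k+1}z) appears, and its
terms in z cancel. The power p^{k(k+1)} in `eigRem` is chosen for this. -/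
theorem eigRem_sub_eigRem {q p : S} (hpq : p * q = 1) (y : S) (k : ℕ) :
    eigRem q p y k - eigRem q p y (k + 1) =
      (p ^ (k * (k + 1)) * (1 - y * p ^ (2 * (k + 1)))) • eigFun q p y k := by
  refine (isUnit_eigDen p (k + 2)).mul_left_cancel ?_
  have h1 := eigDen_mul_eigRem q p y k
  have h2 := eigDen_mul_eigRem q p y (k + 1)
  have h3 := eigDen_mul_eigFun q p y k
  have h4 : eigDen p (k + 2) = eigDen p (k + 1) * (1 + C (p ^ (k + 1)) * X) :=
    Finset.prod_range_succ _ _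
  have h5 : eigNum q y (k + 1) = eigNum q y k * (C y + C (q ^ (k + 1)) * X) :=
    Finset.prod_range_succ _ _
  have h6 : C p ^ (k + 1) * C q ^ (k + 1) = (1 : PowerSeries S) := by
    rw [← mul_pow, ← map_mul, hpq, map_one, one_pow]
  rw [smul_eq_C_mul, mul_left_comm, h3, mul_sub, h2, h4, h5]
  simp only [map_mul, map_sub, map_pow, map_one] at h1 ⊢
  linear_combination (1 + C p ^ (k + 1) * X) * h1
    - C p ^ (k * (k + 1)) * C p ^ (k + 1) * X * eigNum q y k * h6

theorem eigRem_zero_eq (q p y : S) (M : ℕ) (hpq : p * q = 1) :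
    eigRem q p y 0 = ∑ k ∈ Finset.range M,
      (p ^ (k * (k + 1)) * (1 - y * p ^ (2 * (k + 1)))) • eigFun q p y k + eigRem q p y M := by
  simp only [← eigRem_sub_eigRem hpq, Finset.sum_range_sub']
  ring

/-- `eigRem q p y 0` is 1/(1+z), so the operator sends it to D_q(y+z) = 1. -/
theorem motzkinOp_eigRem_zero (q p y : S) : motzkinOp q y (eigRem q p y 0) = 1 := by
  have h := eigDen_mul_eigRem q p y 0
  simp only [eigDen, eigNum, zero_add, Finset.prod_range_one, Finset.prod_range_zero, zero_mul,
    pow_zero, map_one, one_mul] at h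
  rw [motzkinOp_apply, mul_right_comm, h, one_mul]
  ext h
  rw [coeff_qDeriv, map_add, coeff_C, coeff_X, coeff_one]
  cases h <;> simp [qInt]

theorem coeff_zero_eigFun (q p y : S) (k : ℕ) : coeff 0 (eigFun q p y k) = y ^ k := by
  have h := congrArg (coeff 0) (eigDen_mul_eigFun q p y k)
  simpa [eigDen, eigNum] using h

/-! ### The remainder is negligible modulo powers of y -/

/-- The coefficient of `z^h` is divisible by `y^(M-h)` for all `h`. -/
def HighOrder (y : S) (M : ℕ) (f : PowerSeries S) : Prop := ∀ h, y ^ (M - h) ∣ coeff h f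

theorem HighOrder.mul_left {y : S} {M : ℕ} {f : PowerSeries S} (hf : HighOrder y M f)
    (g : PowerSeries S) : HighOrder y M (g * f) := by
  intro h
  rw [coeff_mul]
  refine Finset.dvd_sum fun ⟨a, b⟩ hab => Dvd.dvd.mul_left ?_ _
  have := Finset.HasAntidiagonal.mem_antidiagonal.1 hab
  exact (pow_dvd_pow y (by simp only at this; omega)).trans (hf b)

theorem HighOrder.linear_mul {y : S} {M : ℕ} {f : PowerSeries S} (hf : HighOrder y M f) (c : S) :
    HighOrder y (M + 1) ((C y + C c * X) * f) := by
  intro h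
  rw [add_mul, mul_assoc, map_add, coeff_C_mul, coeff_C_mul]
  refine dvd_add ?_ (Dvd.dvd.mul_left ?_ c)
  · refine (pow_dvd_pow y (n := M - h + 1) (by omega)).trans ?_
    rw [pow_succ']
    exact mul_dvd_mul_left y (hf h)
  · cases h with
    | zero => simp
    | succ h => rw [coeff_succ_X_mul, Nat.add_sub_add_right]; exact hf h

theorem HighOrder.qDeriv {y : S} {M : ℕ} {f : PowerSeries S} (hf : HighOrder y (M + 1) f) (q : S) :
    HighOrder y M (qDeriv q f) := by
  intro h
  rw [coeff_qDeriv, ← Nat.add_sub_add_right M 1 h]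
  exact (hf _).mul_left _

/-- The factor y + z raises the order by one, which makes up for the one lost by the q-derivative.
-/
theorem HighOrder.motzkinOp {y : S} {M : ℕ} {f : PowerSeries S} (hf : HighOrder y M f) (q : S) :
    HighOrder y M (motzkinOp q y f) := by
  rw [motzkinOp_apply, mul_assoc]
  refine ((HighOrder.mul_left ?_ _)).qDeriv q
  simpa using hf.linear_mul 1

theorem HighOrder.motzkinOp_pow {y : S} {M : ℕ} {f : PowerSeries S} (hf : HighOrder y M f) (q : S)
    (n : ℕ) : HighOrder y M ((PASEP.motzkinOp q y ^ n) f) := by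
  induction n with
  | zero => simpa using hf
  | succ n ih => rw [pow_succ', Module.End.mul_apply]; exact ih.motzkinOp q

theorem highOrder_eigRem (q p y : S) (M : ℕ) : HighOrder y M (eigRem q p y M) := by
  have : HighOrder y M (eigNum q y M) := by
    induction M with
    | zero => intro h; simp
    | succ M ih =>
      rw [eigNum, Finset.prod_range_succ, mul_comm]
      exact ih.linear_mul _
  rw [eigRem, mul_comm (eigNum q y M)]
  exact (this.mul_left _).mul_left _

theorem motzkinSeries_expansion [IsDomain S] {q p : S} (hpq : p * q = 1) (hq : q ≠ 1) (y : S)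
    (n M : ℕ) : y ^ M ∣ ∑ X : Config n, y ^ numParticles X * wordWeight q X 0 -
      ∑ k ∈ Finset.range M, p ^ (k * (k + 1)) * (1 - y * p ^ (2 * (k + 1))) *
        (qInt q (k + 1) * (1 - y * p ^ (k + 1))) ^ (n + 1) * y ^ k := by
  -- Writing 1 as the image of 1/(1+z) costs one more application of the operator; hence the
  -- exponent `n + 1`.
  have h1 : motzkinSeries q y n = (motzkinOp q y ^ (n + 1)) (eigRem q p y 0) := by
    rw [pow_succ, Module.End.mul_apply, motzkinOp_eigRem_zero, motzkinSeries_eq_pow]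
  have hpow (k : ℕ) : (motzkinOp q y ^ (n + 1)) (eigFun q p y k) =
      (qInt q (k + 1) * (1 - y * p ^ (k + 1))) ^ (n + 1) • eigFun q p y k := by
    induction n + 1 with
    | zero => simp
    | succ n ih =>
      rw [pow_succ', Module.End.mul_apply, ih, map_smul, motzkinOp_eigFun hpq hq, smul_smul,
        ← pow_succ]
  rw [eigRem_zero_eq q p y M hpq, map_add, map_sum] at h1
  have h2 := congrArg (coeff 0) h1
  have h3 := (highOrder_eigRem q p y M).motzkinOp_pow q (n + 1) 0
  rw [map_add, map_sum] at h2
  simp only [map_smul, hpow, smul_eq_mul, coeff_zero_eigFun, ← mul_assoc] at h2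
  rw [motzkinSeries, coeff_mk] at h2
  rw [h2, add_sub_cancel_left]
  exact h3

end Eigen

/-! ### The number of particles and the `q`-Eulerian numbers -/

section

open Polynomial

theorem coeff_one_sub_C_mul_X_pow {R : Type*} [CommRing R] (a : R) (n i : ℕ) :
    ((1 - C a * X : R[X]) ^ n).coeff i = (-a) ^ i * n.choose i := by
  have : (1 - C a * X : R[X]) ^ n = ((1 + X) ^ n).comp (C (-a) * X) := by
    simp [sub_eq_add_neg]
  rw [this, comp_C_mul_X_coeff, coeff_one_add_X_pow, mul_comm]

theorem coeff_one_sub_mul_one_sub_pow {R : Type*} [CommRing R] (a : R) (n i : ℕ) :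
    ((1 - C (a ^ 2) * X) * (1 - C a * X : R[X]) ^ n).coeff i =
      (-1) ^ i * a ^ i * (n.choose i + a * if i = 0 then 0 else (n.choose (i - 1) : R)) := by
  rw [sub_mul, one_mul, mul_assoc, coeff_sub, coeff_C_mul, coeff_one_sub_C_mul_X_pow, neg_pow]
  cases i with
  | zero => simp
  | succ i =>
    rw [coeff_X_mul, coeff_one_sub_C_mul_X_pow, neg_pow]
    simp
    ring

theorem coeff_sum_pow_numParticles {R : Type*} [CommRing R] (q : R) (n k : ℕ) :
    (∑ Y : Config n, (X : R[X]) ^ numParticles Y * wordWeight (C q) Y 0).coeff k =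
      ∑ X ∈ Finset.univ.filter (fun X : Config n => numParticles X = k), wordWeight q X 0 := by
  rw [finsetSum_coeff, Finset.sum_filter]
  refine Finset.sum_congr rfl fun X _ => ?_
  rw [← map_wordWeight, mul_comm, coeff_C_mul, coeff_X_pow]
  simp [eq_comm]

/-- The expansion is applied over `R[X]` with `y = X`; truncation at `k + 1` terms determines the
coefficient of y^k. The eigenfunction of index `k - i` contributes y^(k-i), so the coefficient of
y^i is needed from the rest. -/
theorem sum_wordWeight_eq {R : Type*} [CommRing R] [IsDomain R] {q p : R} (hpq : p * q = 1)
    (hq : q ≠ 1) (n k : ℕ) :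
    ∑ X ∈ Finset.univ.filter (fun X : Config n => numParticles X = k), wordWeight q X 0 =
      ∑ i ∈ Finset.range (k + 1), p ^ ((k - i) * (k - i + 1)) * qInt q (k - i + 1) ^ (n + 1) *
        ((-1) ^ i * (p ^ (k - i + 1)) ^ i * ((n + 1).choose i +
          p ^ (k - i + 1) * if i = 0 then 0 else ((n + 1).choose (i - 1) : R))) := by
  have hC : (C p : R[X]) * C q = 1 := by rw [← map_mul, hpq, map_one]
  have hq' : (C q : R[X]) ≠ 1 := by rwa [Ne, ← map_one C, C_inj]
  have h := X_pow_dvd_iff.1 (motzkinSeries_expansion hC hq' X n (k + 1)) k k.lt_succ_self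
  rw [coeff_sub, sub_eq_zero, coeff_sum_pow_numParticles] at h
  rw [h, finsetSum_coeff, ← Finset.sum_range_reflect]
  refine Finset.sum_congr rfl fun i hi => ?_
  have hik : i ≤ k := Nat.lt_succ_iff.1 (Finset.mem_range.1 hi)
  rw [show k + 1 - 1 - i = k - i by omega]
  generalize hj : k - i = j
  obtain rfl : k = i + j := by omega
  have hp : (C p : R[X]) ^ (j * (j + 1)) * (1 - X * C p ^ (2 * (j + 1))) *
      (qInt (C q) (j + 1) * (1 - X * C p ^ (j + 1))) ^ (n + 1) =
      C (p ^ (j * (j + 1)) * qInt q (j + 1) ^ (n + 1)) *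
        ((1 - C ((p ^ (j + 1)) ^ 2) * X) * (1 - C (p ^ (j + 1)) * X) ^ (n + 1)) := by
    rw [mul_pow, ← map_qInt, ← pow_mul, mul_comm 2, C_mul, C_pow, C_pow, C_pow, C_pow]
    ring
  rw [hp, coeff_mul_X_pow, coeff_C_mul, coeff_one_sub_mul_one_sub_pow]

end

section

open LaurentPolynomial

theorem sum_wordWeight_T_eq_qEulerian (n k : ℕ) :
    ∑ X ∈ Finset.univ.filter (fun X : Config n => numParticles X = k),
      wordWeight (T 1 : LaurentPolynomial ℤ) X 0 = qEulerian (k + 1) (n + 1) := by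
  have hpq : (T (-1) : LaurentPolynomial ℤ) * T 1 = 1 := by rw [← T_add, neg_add_cancel, T_zero]
  have hq : (T 1 : LaurentPolynomial ℤ) ≠ 1 := by
    rw [← Polynomial.toLaurent_X, ← map_one Polynomial.toLaurent, Ne,
      Polynomial.toLaurent_injective.eq_iff]
    exact fun h => by simpa using congrArg (Polynomial.eval 0) h
  rw [sum_wordWeight_eq hpq hq, qEulerian, Finset.mul_sum]
  refine Finset.sum_congr rfl fun i hi => ?_
  have hik : i ≤ k := Nat.lt_succ_iff.1 (Finset.mem_range.1 hi)
  obtain ⟨j, rfl⟩ := Nat.exists_eq_add_of_le hik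
  rw [show i + j - i = j by omega, show i + j + 1 - i = j + 1 by omega]
  -- With K = i + j + 1, both sides have exponent -(K-1)(K-i) = -(i+j)(j+1).
  have e1 : (T (-1) : LaurentPolynomial ℤ) ^ (j * (j + 1)) * (T (-1) ^ (j + 1)) ^ i =
      T (((i + j + 1 : ℕ) : ℤ) - ((i + j + 1 : ℕ) : ℤ) ^ 2) *
        T (((i + j + 1 : ℕ) : ℤ) * ((i : ℤ) - 1)) *
        T (((i + j + 1 : ℕ) : ℤ) - (i : ℤ)) := by
    rw [← pow_mul, ← pow_add, T_pow, ← T_add, ← T_add]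
    congr 1
    push_cast
    ring
  have e2 : (T (-1) : LaurentPolynomial ℤ) ^ (j + 1) * T (((i + j + 1 : ℕ) : ℤ) - (i : ℤ)) = 1 := by
    rw [T_pow, ← T_add, ← T_zero]
    congr 1
    push_cast
    ring
  linear_combination (qInt (T 1) (j + 1) ^ (n + 1) * (-1) ^ i * (((n + 1).choose i) +
      T (-1) ^ (j + 1) * (if i = 0 then 0 else ((n + 1).choose (i - 1) : LaurentPolynomial ℤ)))) * e1
    + T (((i + j + 1 : ℕ) : ℤ) - ((i + j + 1 : ℕ) : ℤ) ^ 2) *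
        T (((i + j + 1 : ℕ) : ℤ) * ((i : ℤ) - 1)) * (qInt (T 1) (j + 1) ^ (n + 1) * (-1) ^ i *
        (if i = 0 then 0 else ((n + 1).choose (i - 1) : LaurentPolynomial ℤ))) * e2

end

end PASEP

/-! ### The theorem -/

theorem mainTheorem6 (n : ℕ) :
    ∃ E : ℕ → Polynomial ℤ,
      (∀ k : ℕ, Polynomial.toLaurent (E k) = PASEP.qEulerian (k + 1) (n + 1)) ∧
      ∀ q : ℝ, 0 ≤ q → q ≤ 1 →
        ∃ π : PASEP.Config n → ℝ,
          PASEP.IsStationary (PASEP.transitionMatrix n 1 1 q) π ∧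
          (∀ π' : PASEP.Config n → ℝ,
            PASEP.IsStationary (PASEP.transitionMatrix n 1 1 q) π' → π' = π) ∧
          0 < PASEP.Z n 1 1 q ∧
          ∀ k : ℕ,
            ∑ X ∈ Finset.univ.filter (fun X : PASEP.Config n => PASEP.numParticles X = k), π X =
              Polynomial.aeval q (E k) / PASEP.Z n 1 1 q := by
  -- The witness is the total weight of the words with `k` particles, computed in ℤ[q].
  refine ⟨fun k => ∑ X ∈ Finset.univ.filter (fun X : PASEP.Config n => PASEP.numParticles X = k),
    PASEP.wordWeight Polynomial.X X 0, fun k => ?_, fun q hq hq1 => ⟨_,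
    PASEP.isStationary_wordWeight hq n,
    fun π' hπ' => PASEP.isStationary_unique hq hq1 (PASEP.isStationary_wordWeight hq n) hπ',
    PASEP.Z_pos hq n, fun k => ?_⟩⟩
  · rw [← PASEP.sum_wordWeight_T_eq_qEulerian, map_sum]
    simp only [PASEP.map_wordWeight, Polynomial.toLaurent_X]
  · rw [← Finset.sum_div, map_sum]
    congr 1
    refine Finset.sum_congr rfl fun X _ => ?_
    have := PASEP.map_wordWeight (Polynomial.aeval (R := ℤ) q).toRingHom Polynomial.X X 0
    simpa using this.symm
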